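/- Let $n\ge 2$ and $d\ge 1$ be integers, let $z=(z_1,\dots,z_n)$ be coordinates in $\mathbb C^n$ and $|z|^2=\sum_i|z_i|^2$. For homogeneous polynomials $p_1,\dots,p_m\in\mathbb C[z]$ of degree $d$, let $S=S(p)$ be the complex vector space of homogeneous polynomials $r(z)$ of degree $d-1$ (the zero polynomial included) for which there are linear forms $q_1,\dots,q_m$ (homogeneous of degree $1$, depending on $r$) with $$\sum_{j=1}^m p_j(z)\,q_j(\bar z)=r(z)\,|z|^2\qquad\text{for all } z\in\mathbb C^n. \tag{$*$}$$ 1. Let $p_1,\dots,p_m$ be homogeneous of degree $d$ and linearly independent over $\mathbb C$. If $m<\sum_{j=0}^{k}(n-j)$ for some integer $0\le k\le n-1$, then $\dim S\le k$. Moreover, whenever $q=(q_1,\dots,q_m)$ and $r$ (with the $q_j$ linear forms and $r$ homogeneous of degree $d-1$) satisfy $(*)$, then $r\equiv 0$ if and only if $q\equiv 0$. Consequently, the space of all tuples $q$ of linear forms for which there is a homogeneous $r$ of degree $d-1$ satisfying $(*)$ also has dimension $\dim S$. 2. The estimate is sharp: let $d\ge 2$ and $0\le k\le n-1$. For every $m$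 with $\sum_{j=0}^{k-1}(n-j)\le m<\sum_{j=0}^{k}(n-j)$ there are linearly independent homogeneous polynomials $p_1,\dots,p_m$ of degree $d$ with $\dim S=k$; and for $m=\sum_{j=0}^{k}(n-j)$ there are such polynomials with $\dim S>k$. -/

import Mathlib

/-- `q = (q₁, …, q_m)` and `r` solve the equation
`∑ⱼ pⱼ(z) qⱼ(z̄) = r(z) |z|²` for all `z ∈ ℂⁿ`, where `|z|` is the Euclidean norm,
every `qⱼ` is a linear form and `r` is a homogeneous polynomial of degree `e`. -/
structure IsSol {n m : ℕ} (e : ℕ) (p q : Fin m → MvPolynomial (Fin n) ℂ)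
    (r : MvPolynomial (Fin n) ℂ) : Prop where
  linear : ∀ j, (q j).IsHomogeneous 1
  homogeneous : r.IsHomogeneous e
  eqn : ∀ z : EuclideanSpace ℂ (Fin n),
    ∑ j, MvPolynomial.eval (fun i => z i) (p j) *
        MvPolynomial.eval (fun i => (starRingEnd ℂ) (z i)) (q j) =
      MvPolynomial.eval (fun i => z i) r * ((‖z‖ ^ 2 : ℝ) : ℂ)

theorem IsSol.zero {n m : ℕ} (e : ℕ) (p : Fin m → MvPolynomial (Fin n) ℂ) :
    IsSol e p 0 0 where
  linear _ := MvPolynomial.isHomogeneous_zero _ _ _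
  homogeneous := MvPolynomial.isHomogeneous_zero _ _ _
  eqn z := by simp

theorem IsSol.add {n m e : ℕ} {p q q' : Fin m → MvPolynomial (Fin n) ℂ}
    {r r' : MvPolynomial (Fin n) ℂ} (h : IsSol e p q r) (h' : IsSol e p q' r') :
    IsSol e p (q + q') (r + r') where
  linear j := (h.linear j).add (h'.linear j)
  homogeneous := h.homogeneous.add h'.homogeneous
  eqn z := by
    simp only [Pi.add_apply, map_add, mul_add, add_mul, Finset.sum_add_distrib, h.eqn z, h'.eqn z]

theorem IsSol.smul {n m e : ℕ} {p q : Fin m → MvPolynomial (Fin n) ℂ}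
    {r : MvPolynomial (Fin n) ℂ} (c : ℂ) (h : IsSol e p q r) :
    IsSol e p (c • q) (c • r) where
  linear j := (MvPolynomial.homogeneousSubmodule (Fin n) ℂ 1).smul_mem c (h.linear j)
  homogeneous := (MvPolynomial.homogeneousSubmodule (Fin n) ℂ e).smul_mem c h.homogeneous
  eqn z := by
    simp only [Pi.smul_apply, MvPolynomial.smul_eval, mul_left_comm _ c, ← Finset.mul_sum,
      h.eqn z, mul_assoc]

/-- The space `S` of all homogeneous polynomials `r` of degree `e` for which there are
linear forms `q₁, …, q_m` with `∑ⱼ pⱼ(z) qⱼ(z̄) = r(z) |z|²`. -/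
def spaceS {n m : ℕ} (e : ℕ) (p : Fin m → MvPolynomial (Fin n) ℂ) :
    Submodule ℂ (MvPolynomial (Fin n) ℂ) where
  carrier := {r | ∃ q : Fin m → MvPolynomial (Fin n) ℂ, IsSol e p q r}
  zero_mem' := ⟨0, IsSol.zero e p⟩
  add_mem' := fun ⟨q, h⟩ ⟨q', h'⟩ => ⟨q + q', h.add h'⟩
  smul_mem' := fun c _ ⟨q, h⟩ => ⟨c • q, h.smul c⟩

/-- The space of all tuples `q = (q₁, …, q_m)` of linear forms for which there is a
homogeneous polynomial `r` of degree `e` with `∑ⱼ pⱼ(z) qⱼ(z̄) = r(z) |z|²`. -/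
def spaceQ {n m : ℕ} (e : ℕ) (p : Fin m → MvPolynomial (Fin n) ℂ) :
    Submodule ℂ (Fin m → MvPolynomial (Fin n) ℂ) where
  carrier := {q | ∃ r : MvPolynomial (Fin n) ℂ, IsSol e p q r}
  zero_mem' := ⟨0, IsSol.zero e p⟩
  add_mem' := fun ⟨r, h⟩ ⟨r', h'⟩ => ⟨r + r', h.add h'⟩
  smul_mem' := fun c _ ⟨r, h⟩ => ⟨c • r, h.smul c⟩

/-!
Comparing the coefficients of `z̄ᵢ`, a polynomial `r` lies in `S` exactly when it is homogeneous of
degree `d - 1` and all products `zᵢ r` lie in the span of the `pⱼ` (`mem_spaceS_iff`). So the bound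
on `dim S` says that multiplication by the variables enlarges a space of polynomials: if
`dim S ≥ k + 1`, then the products `zᵢ r` span at least `n + (n - 1) + ⋯ + (n - k)` dimensions.

Fixing a monomial order reduces this to monomials (`rank_le_of_mul_X_mem_span`). The dimension of a
space of polynomials is its number of leading exponents, and if `a` is a leading exponent of `S`,
then every `a + eᵢ` is one of the span. Two distinct monomials have at most one product with a
variable in common, so the `j`-th of `k + 1` monomials contributes at least `n - j` new products
(`sum_le_card_varShift`).

For sharpness, `S` is made to contain the `k` monomials `z₀^(d-2) zⱼ`, `j < k`. They have only
`n + (n - 1) + ⋯ + (n - k + 1)` products with variables; these, together with further monomials of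
degree `d`, are taken as the `pⱼ` (`exists_le_rank_spaceS`). The upper bound for `dim S` is then the
first part.
-/

/-! ### Shifting monomials by the variables -/

/-- The exponents `a + eᵢ` with `a ∈ A`: the exponents of the products of a variable with a monomial
whose exponent lies in `A`. -/
noncomputable def varShift {σ : Type*} [Fintype σ] [DecidableEq σ] (A : Finset (σ →₀ ℕ)) : Finset (σ →₀ ℕ) :=
  A.biUnion fun a => Finset.univ.image fun i => a + Finsupp.single i 1

theorem mem_varShift {σ : Type*} [Fintype σ] [DecidableEq σ] {A : Finset (σ →₀ ℕ)} {b : σ →₀ ℕ} :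
    b ∈ varShift A ↔ ∃ a ∈ A, ∃ i, a + Finsupp.single i 1 = b := by
  simp [varShift]

/-- For `a ≠ b` the monomial `z^a` has at most one multiple by a variable in common with `z^b`,
because `z^a / z^b = z_l / z_i` determines `i`. -/
theorem shift_index_unique {σ : Type*} {a b : σ →₀ ℕ} (hab : a ≠ b) {i l i' l' : σ}
    (h : a + Finsupp.single i 1 = b + Finsupp.single l 1)
    (h' : a + Finsupp.single i' 1 = b + Finsupp.single l' 1) : i = i' := by
  classical
  by_contra hne
  have hil : i ≠ l := by
    rintro rfl
    exact hab (add_right_cancel h)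
  have h1 := DFunLike.congr_fun h i
  have h2 := DFunLike.congr_fun h' i
  simp only [Finsupp.add_apply, Finsupp.single_apply, if_neg (Ne.symm hil),
    if_neg (Ne.symm hne), if_true] at h1 h2
  omega

/-- Adding the exponents of `A` one at a time, the `j`-th one (counted from `0`) contributes at
least `|σ| - j` new exponents, as it shares at most one with each of the `j` earlier ones. -/
theorem sum_le_card_varShift {σ : Type*} [Fintype σ] [DecidableEq σ] (A : Finset (σ →₀ ℕ)) :
    ∑ j ∈ Finset.range A.card, (Fintype.card σ - j) ≤ (varShift A).card := by
  induction A using Finset.induction_on with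
  | empty => simp
  | insert a A ha ih =>
    set N : Finset (σ →₀ ℕ) := Finset.univ.image fun i => a + Finsupp.single i 1 with hN
    have hNcard : N.card = Fintype.card σ := by
      rw [hN, Finset.card_image_of_injective _ fun i j h =>
        Finsupp.single_left_injective one_ne_zero (add_left_cancel h), Finset.card_univ]
    have hinter : (varShift A ∩ N).card ≤ A.card := by
      rw [varShift, Finset.biUnion_inter]
      refine (Finset.card_biUnion_le_card_mul _ _ 1 fun b hb => ?_).trans (mul_one _).le
      refine Finset.card_le_one.2 fun x hx y hy => ?_
      simp only [hN, Finset.mem_inter, Finset.mem_image, Finset.mem_univ, true_and] at hx hy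
      obtain ⟨⟨l, hl⟩, i, rfl⟩ := hx
      obtain ⟨⟨l', hl'⟩, i', rfl⟩ := hy
      have hab : a ≠ b := (ne_of_mem_of_not_mem hb ha).symm
      rw [shift_index_unique hab hl.symm hl'.symm]
    have hunion : varShift (insert a A) = N ∪ varShift A := by
      rw [varShift, Finset.biUnion_insert]
      rfl
    have hcard := Finset.card_union_add_card_inter N (varShift A)
    rw [Finset.inter_comm] at hcard
    have hsubset := Finset.card_le_card (Finset.subset_union_right (s₁ := N) (s₂ := varShift A))
    rw [Finset.card_insert_of_notMem ha, Finset.sum_range_succ, hunion]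
    omega

/-! ### Dimension and leading exponents -/

/-- A space of polynomials of dimension greater than `k` has at least `k + 1` leading exponents:
an element is determined by its coefficients at the leading exponents of the space. -/
theorem exists_leading_exponents_of_lt_rank {σ K : Type*} [Field K] (mo : MonomialOrder σ)
    (W : Submodule K (MvPolynomial σ K)) {k : ℕ} (h : (k : Cardinal) < Module.rank K W) :
    ∃ A : Finset (σ →₀ ℕ), A.card = k + 1 ∧ ∀ a ∈ A, ∃ r ∈ W, r ≠ 0 ∧ mo.degree r = a := by
  by_contra hcon
  push Not at hcon
  set D : Set (σ →₀ ℕ) := {a | ∃ r ∈ W, r ≠ 0 ∧ mo.degree r = a} with hD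
  have hno : ∀ A : Finset (σ →₀ ℕ), (A : Set (σ →₀ ℕ)) ⊆ D → A.card ≠ k + 1 := by
    intro A hA hc
    obtain ⟨a, ha, hr⟩ := hcon A hc
    obtain ⟨r, hrW, hr0, hra⟩ := hA ha
    exact hr r hrW hr0 hra
  have hfin : D.Finite := by
    by_contra hinf
    obtain ⟨A, hA, hc⟩ := Set.Infinite.exists_subset_card_eq hinf (k + 1)
    exact hno A hA hc
  have hle : hfin.toFinset.card ≤ k := by
    by_contra hgt
    obtain ⟨A, hA, hc⟩ := Finset.exists_subset_card_eq (not_le.1 hgt)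
    exact hno A (fun a ha => hfin.mem_toFinset.1 (hA ha)) hc
  let φ : W →ₗ[K] (hfin.toFinset → K) :=
    LinearMap.pi fun a => (MvPolynomial.lcoeff K a.1).comp W.subtype
  have hφ : Function.Injective φ := by
    rw [← LinearMap.ker_eq_bot, LinearMap.ker_eq_bot']
    intro r hr
    by_contra hr0
    have hr0' : (r : MvPolynomial σ K) ≠ 0 := fun h => hr0 (Subtype.ext h)
    have := congrFun hr ⟨mo.degree (r : MvPolynomial σ K),
      hfin.mem_toFinset.2 ⟨r, r.2, hr0', rfl⟩⟩
    exact mo.coeff_degree_ne_zero_iff.2 hr0' this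
  have hrank := LinearMap.lift_rank_le_of_injective φ hφ
  rw [rank_fun', Cardinal.lift_natCast, Fintype.card_coe] at hrank
  have h' := Cardinal.lift_lt.2 h
  rw [Cardinal.lift_natCast] at h'
  exact absurd (h'.trans_le hrank) (not_lt.2 (by exact_mod_cast hle))

theorem linearIndependent_of_injective_degree {ι σ K : Type*} [Field K] (mo : MonomialOrder σ)
    (f : ι → MvPolynomial σ K) (hf : ∀ i, f i ≠ 0)
    (hinj : Function.Injective fun i => mo.degree (f i)) : LinearIndependent K f := by
  classical
  rw [linearIndependent_iff']
  intro s g hg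
  by_contra! hne
  obtain ⟨i₀, hi₀, hgi₀⟩ := hne
  obtain ⟨i, hi, hmax⟩ := Finset.exists_max_image (s.filter fun i => g i ≠ 0)
    (fun i => mo.toSyn (mo.degree (f i))) ⟨i₀, Finset.mem_filter.2 ⟨hi₀, hgi₀⟩⟩
  rw [Finset.mem_filter] at hi
  have hc := congrArg (MvPolynomial.coeff (mo.degree (f i))) hg
  rw [MvPolynomial.coeff_sum, Finset.sum_eq_single i] at hc
  · rw [MvPolynomial.coeff_smul, MvPolynomial.coeff_zero, smul_eq_mul] at hc
    exact (mul_ne_zero hi.2 (mo.coeff_degree_ne_zero_iff.2 (hf i))) hc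
  · intro j hj hji
    rw [MvPolynomial.coeff_smul, smul_eq_mul]
    by_cases hgj : g j = 0
    · rw [hgj, zero_mul]
    · rw [mo.coeff_eq_zero_of_lt, mul_zero]
      refine lt_of_le_of_ne (hmax j (Finset.mem_filter.2 ⟨hj, hgj⟩)) fun h => hji ?_
      exact hinj (mo.toSyn.injective h)
  · exact fun h => absurd hi.1 h

/-- If all products of variables with elements of `W` lie in a space spanned by too few polynomials,
then `W` is small: compare leading exponents. -/
theorem rank_le_of_mul_X_mem_span {σ K : Type*} [Field K] [Fintype σ] [LinearOrder σ]
    (W : Submodule K (MvPolynomial σ K)) {m k : ℕ} (p : Fin m → MvPolynomial σ K)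
    (hW : ∀ r ∈ W, ∀ i, r * MvPolynomial.X i ∈ Submodule.span K (Set.range p))
    (hm : m < ∑ j ∈ Finset.range (k + 1), (Fintype.card σ - j)) :
    Module.rank K W ≤ (k : Cardinal) := by
  by_contra hlt
  let mo : MonomialOrder σ := MonomialOrder.lex
  obtain ⟨A, hA, hAW⟩ := exists_leading_exponents_of_lt_rank mo W (not_le.1 hlt)
  set P := Submodule.span K (Set.range p)
  have hB : ∀ b : varShift A, ∃ f : P, (f : MvPolynomial σ K) ≠ 0 ∧
      mo.degree (f : MvPolynomial σ K) = b := by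
    rintro ⟨b, hb⟩
    obtain ⟨a, ha, i, rfl⟩ := mem_varShift.1 hb
    obtain ⟨r, hr, hr0, rfl⟩ := hAW a ha
    refine ⟨⟨r * MvPolynomial.X i, hW r hr i⟩, mul_ne_zero hr0 (MvPolynomial.X_ne_zero i), ?_⟩
    rw [mo.degree_mul hr0 (MvPolynomial.X_ne_zero i), mo.degree_X]
  choose f hf0 hfdeg using hB
  have hli : LinearIndependent K f := by
    refine LinearIndependent.of_comp P.subtype
      (linearIndependent_of_injective_degree mo _ hf0 fun b b' h => ?_)
    exact Subtype.ext ((hfdeg b).symm.trans (h.trans (hfdeg b')))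
  have : FiniteDimensional K P := FiniteDimensional.span_of_finite K (Set.finite_range p)
  have h1 : (varShift A).card ≤ Module.finrank K P := by
    simpa using hli.fintype_card_le_finrank
  have h2 : Module.finrank K P ≤ m := (finrank_range_le_card p).trans (Fintype.card_fin m).le
  have h3 := sum_le_card_varShift A
  rw [hA] at h3
  omega

/-! ### Comparing coefficients of the conjugate variables -/

/-- The functions `z̄ᵢ` on `ℂⁿ` are linearly independent over the polynomials in `z`: a polynomial
in `z, z̄` becomes one in the real coordinates, and vanishes identically if it vanishes at all real
points. -/
theorem eq_zero_of_sum_eval_mul_conj_eq_zero {σ : Type*} [Fintype σ] (g : σ → MvPolynomial σ ℂ)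
    (h : ∀ z : σ → ℂ, ∑ i, MvPolynomial.eval z (g i) * (starRingEnd ℂ) (z i) = 0) (i : σ) :
    g i = 0 := by
  classical
  -- `F (x, y)` is the sum at `z = x + I y`, with `z̄` replaced by `x - I y`.
  let F : MvPolynomial (σ ⊕ σ) ℂ := ∑ i,
    MvPolynomial.bind₁ (fun k => MvPolynomial.X (Sum.inl k) +
      MvPolynomial.C Complex.I * MvPolynomial.X (Sum.inr k)) (g i) *
    (MvPolynomial.X (Sum.inl i) - MvPolynomial.C Complex.I * MvPolynomial.X (Sum.inr i))
  have hF : ∀ x : σ ⊕ σ → ℂ, MvPolynomial.eval x F =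
      ∑ i, MvPolynomial.eval (fun k => x (Sum.inl k) + Complex.I * x (Sum.inr k)) (g i) *
        (x (Sum.inl i) - Complex.I * x (Sum.inr i)) := by
    intro x
    simp only [F, map_sum, map_mul, map_sub, MvPolynomial.eval_X, MvPolynomial.eval_C]
    refine Finset.sum_congr rfl fun i _ => ?_
    congr 1
    rw [← MvPolynomial.coe_aeval_eq_eval, RingHom.coe_coe, MvPolynomial.aeval_bind₁]
    simp [← MvPolynomial.aeval_eq_eval]
  have hF0 : F = 0 := by
    refine MvPolynomial.funext_set (fun _ => Set.range Complex.ofReal)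
      (fun _ => Set.infinite_range_of_injective Complex.ofReal_injective) fun x hx => ?_
    rw [hF, map_zero, ← h fun k => x (Sum.inl k) + Complex.I * x (Sum.inr k)]
    refine Finset.sum_congr rfl fun i _ => ?_
    obtain ⟨a, ha⟩ := hx (Sum.inl i) trivial
    obtain ⟨b, hb⟩ := hx (Sum.inr i) trivial
    rw [← ha, ← hb]
    simp [sub_eq_add_neg]
  refine MvPolynomial.funext fun z => ?_
  -- Choose `x, y` with `x + I y = z` and `x - I y = eᵢ`.
  let w : σ → ℂ := Pi.single i 1
  have key := hF (Sum.elim (fun k => (z k + w k) / 2) (fun k => -Complex.I * (z k - w k) / 2))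
  have hplus : ∀ k, (z k + w k) / 2 + Complex.I * (-Complex.I * (z k - w k) / 2) = z k := by
    intro k
    linear_combination (-(z k - w k) / 2) * Complex.I_mul_I
  have hminus : ∀ k, (z k + w k) / 2 - Complex.I * (-Complex.I * (z k - w k) / 2) = w k := by
    intro k
    linear_combination ((z k - w k) / 2) * Complex.I_mul_I
  simp only [Sum.elim_inl, Sum.elim_inr, hplus, hminus, hF0, map_zero] at key
  simpa [w, Pi.single_apply] using key.symm

theorem MvPolynomial.IsHomogeneous.eq_sum_coeff_mul_X {σ R : Type*} [CommSemiring R] [Fintype σ]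
    {q : MvPolynomial σ R} (hq : q.IsHomogeneous 1) :
    q = ∑ i, MvPolynomial.C (q.coeff (Finsupp.single i 1)) * MvPolynomial.X i := by
  classical
  ext a
  simp only [MvPolynomial.coeff_sum, MvPolynomial.coeff_C_mul, MvPolynomial.coeff_X]
  by_cases ha : a.degree = 1
  · obtain ⟨i, rfl⟩ := (Finsupp.sum_eq_one_iff a).1 ha
    simp [Finsupp.single_left_inj]
  · rw [hq.coeff_eq_zero ha, Finset.sum_eq_zero]
    intro i _
    rw [if_neg, mul_zero]
    rintro rfl
    simp at ha

theorem norm_sq_eq_sum_mul_conj {n : ℕ} (z : EuclideanSpace ℂ (Fin n)) :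
    ((‖z‖ ^ 2 : ℝ) : ℂ) = ∑ i, z i * (starRingEnd ℂ) (z i) := by
  rw [EuclideanSpace.norm_sq_eq, Complex.ofReal_sum]
  refine Finset.sum_congr rfl fun i _ => ?_
  rw [Complex.mul_conj, Complex.normSq_eq_norm_sq]

/-- The coefficient of `z̄ᵢ` in the equation `∑ⱼ pⱼ(z) qⱼ(z̄) = r(z) |z|²`. -/
theorem IsSol.sum_coeff_smul {n m e : ℕ} {p q : Fin m → MvPolynomial (Fin n) ℂ}
    {r : MvPolynomial (Fin n) ℂ} (h : IsSol e p q r) (i : Fin n) :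
    ∑ j, (q j).coeff (Finsupp.single i 1) • p j = r * MvPolynomial.X i := by
  rw [← sub_eq_zero]
  refine eq_zero_of_sum_eval_mul_conj_eq_zero (fun i =>
    ∑ j, (q j).coeff (Finsupp.single i 1) • p j - r * MvPolynomial.X i) (fun z => ?_) i
  have hz := h.eqn (WithLp.toLp 2 z)
  have hq : ∀ j, MvPolynomial.eval (fun i => (starRingEnd ℂ) (z i)) (q j) =
      ∑ i, (q j).coeff (Finsupp.single i 1) * (starRingEnd ℂ) (z i) := fun j => by
    conv_lhs => rw [(h.linear j).eq_sum_coeff_mul_X]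
    simp
  rw [norm_sq_eq_sum_mul_conj] at hz
  simp only [hq, Finset.mul_sum] at hz
  rw [Finset.sum_comm] at hz
  simp only [map_sub, map_sum, map_mul, MvPolynomial.smul_eval, MvPolynomial.eval_X, sub_mul,
    Finset.sum_mul, Finset.sum_sub_distrib]
  rw [sub_eq_zero]
  convert hz using 1
  · exact Finset.sum_congr rfl fun i _ => Finset.sum_congr rfl fun j _ => by ring
  · exact Finset.sum_congr rfl fun i _ => by ring

theorem mem_spaceS_iff {n m e : ℕ} {p : Fin m → MvPolynomial (Fin n) ℂ}
    {r : MvPolynomial (Fin n) ℂ} :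
    r ∈ spaceS e p ↔ r.IsHomogeneous e ∧
      ∀ i, r * MvPolynomial.X i ∈ Submodule.span ℂ (Set.range p) := by
  constructor
  · rintro ⟨q, h⟩
    refine ⟨h.homogeneous, fun i => ?_⟩
    rw [← h.sum_coeff_smul i]
    exact Submodule.sum_mem _ fun j _ =>
      Submodule.smul_mem _ _ (Submodule.subset_span (Set.mem_range_self j))
  · rintro ⟨hr, h⟩
    choose c hc using fun i => (Submodule.mem_span_range_iff_exists_fun ℂ).1 (h i)
    refine ⟨fun j => ∑ i, MvPolynomial.C (c i j) * MvPolynomial.X i, fun j =>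
      MvPolynomial.IsHomogeneous.sum _ _ _ fun i _ => MvPolynomial.isHomogeneous_C_mul_X _ _,
      hr, fun z => ?_⟩
    have hz : ∀ i, ∑ j, c i j * MvPolynomial.eval (fun i => z i) (p j) =
        MvPolynomial.eval (fun i => z i) r * z i := fun i => by
      simpa using congrArg (MvPolynomial.eval fun i => z i) (hc i)
    rw [norm_sq_eq_sum_mul_conj]
    simp only [map_sum, map_mul, MvPolynomial.eval_C, MvPolynomial.eval_X, Finset.mul_sum,
      ← mul_assoc, ← hz, Finset.sum_mul]
    rw [Finset.sum_comm]
    exact Finset.sum_congr rfl fun i _ => Finset.sum_congr rfl fun j _ => by ring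

/-! ### Solutions as pairs -/

theorem IsSol.eq_zero_iff {n m e : ℕ} (hn : 0 < n) {p q : Fin m → MvPolynomial (Fin n) ℂ}
    {r : MvPolynomial (Fin n) ℂ} (hp : LinearIndependent ℂ p) (h : IsSol e p q r) :
    r = 0 ↔ q = 0 := by
  constructor
  · rintro rfl
    funext j
    rw [(h.linear j).eq_sum_coeff_mul_X]
    refine Finset.sum_eq_zero fun i _ => ?_
    rw [Fintype.linearIndependent_iff.1 hp _ ((h.sum_coeff_smul i).trans (zero_mul _)) j,
      MvPolynomial.C_0, zero_mul]
  · rintro rfl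
    have := h.sum_coeff_smul ⟨0, hn⟩
    simp only [Pi.zero_apply, MvPolynomial.coeff_zero, zero_smul, Finset.sum_const_zero] at this
    exact (mul_eq_zero.1 this.symm).resolve_right (MvPolynomial.X_ne_zero _)

/-- The space of all pairs `(q, r)` that solve the equation. -/
def solPairs {n m : ℕ} (e : ℕ) (p : Fin m → MvPolynomial (Fin n) ℂ) :
    Submodule ℂ ((Fin m → MvPolynomial (Fin n) ℂ) × MvPolynomial (Fin n) ℂ) where
  carrier := {x | IsSol e p x.1 x.2}
  zero_mem' := IsSol.zero e p
  add_mem' := fun h h' => h.add h'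
  smul_mem' := fun c _ h => h.smul c

/-- Both spaces are injective images of the space of pairs `(q, r)`. -/
theorem rank_spaceQ_eq_rank_spaceS {n m : ℕ} (e : ℕ) (hn : 0 < n)
    {p : Fin m → MvPolynomial (Fin n) ℂ} (hp : LinearIndependent ℂ p) :
    Module.rank ℂ (spaceQ e p) = Module.rank ℂ (spaceS e p) := by
  let f := (LinearMap.fst ℂ _ _).comp (solPairs e p).subtype
  let g := (LinearMap.snd ℂ _ _).comp (solPairs e p).subtype
  have hf : Function.Injective f := by
    rw [← LinearMap.ker_eq_bot, LinearMap.ker_eq_bot']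
    rintro ⟨⟨q, r⟩, hqr⟩ h
    have hqr' : IsSol e p q r := hqr
    exact Subtype.ext (Prod.ext h ((hqr'.eq_zero_iff hn hp).2 h))
  have hg : Function.Injective g := by
    rw [← LinearMap.ker_eq_bot, LinearMap.ker_eq_bot']
    rintro ⟨⟨q, r⟩, hqr⟩ h
    have hqr' : IsSol e p q r := hqr
    exact Subtype.ext (Prod.ext ((hqr'.eq_zero_iff hn hp).1 h) h)
  have hQ : LinearMap.range f = spaceQ e p := by
    ext q
    constructor
    · rintro ⟨⟨⟨q, r⟩, h⟩, rfl⟩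
      exact ⟨r, h⟩
    · rintro ⟨r, h⟩
      exact ⟨⟨(q, r), h⟩, rfl⟩
  have hS : LinearMap.range g = spaceS e p := by
    ext r
    constructor
    · rintro ⟨⟨⟨q, r⟩, h⟩, rfl⟩
      exact ⟨q, h⟩
    · rintro ⟨q, h⟩
      exact ⟨⟨(q, r), h⟩, rfl⟩
  rw [← hQ, ← hS, rank_range_of_injective f hf, rank_range_of_injective g hg]

theorem rank_spaceS_le {n m e k : ℕ} (p : Fin m → MvPolynomial (Fin n) ℂ)
    (hm : m < ∑ j ∈ Finset.range (k + 1), (n - j)) :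
    Module.rank ℂ (spaceS e p) ≤ (k : Cardinal) :=
  rank_le_of_mul_X_mem_span _ p (fun _ hr => (mem_spaceS_iff.1 hr).2) (by simpa using hm)

/-! ### Sharpness -/

/-- The exponents of the monomials `z₀ᶜ zⱼ` with `j < K`. -/
noncomputable def firstExponents (n : ℕ) [NeZero n] (c K : ℕ) : Finset (Fin n →₀ ℕ) :=
  (Finset.univ.filter fun j : Fin n => (j : ℕ) < K).image fun j =>
    Finsupp.single 0 c + Finsupp.single j 1

theorem firstExponents_mono {n : ℕ} [NeZero n] (c : ℕ) {K L : ℕ} (h : K ≤ L) :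
    firstExponents n c K ⊆ firstExponents n c L :=
  Finset.image_subset_image fun j hj => by
    simp only [Finset.mem_filter, Finset.mem_univ, true_and] at hj ⊢
    omega

theorem card_firstExponents {n : ℕ} [NeZero n] (c : ℕ) {K : ℕ} (hK : K ≤ n) :
    (firstExponents n c K).card = K := by
  rw [firstExponents, Finset.card_image_of_injective _ fun i j h =>
    Finsupp.single_left_injective one_ne_zero (add_left_cancel h), Fin.card_filter_val_lt,
    min_eq_right hK]

theorem degree_of_mem_firstExponents {n : ℕ} [NeZero n] {c K : ℕ} {a : Fin n →₀ ℕ}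
    (ha : a ∈ firstExponents n c K) : a.degree = c + 1 := by
  obtain ⟨j, -, rfl⟩ := Finset.mem_image.1 ha
  simp

theorem degree_of_mem_varShift_firstExponents {n : ℕ} [NeZero n] {c K : ℕ} {a : Fin n →₀ ℕ}
    (ha : a ∈ varShift (firstExponents n c K)) : a.degree = c + 2 := by
  obtain ⟨b, hb, i, rfl⟩ := mem_varShift.1 ha
  simp [degree_of_mem_firstExponents hb]

/-- The products `z₀ᶜ zⱼ zᵢ` with `j < K` already occur among those with `j ≤ i`. -/
theorem card_varShift_firstExponents_le {n : ℕ} [NeZero n] (c : ℕ) {K : ℕ} (hK : K ≤ n) :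
    (varShift (firstExponents n c K)).card ≤ ∑ j ∈ Finset.range K, (n - j) := by
  have hsub : varShift (firstExponents n c K) ⊆
      (Finset.univ.filter fun j : Fin n => (j : ℕ) < K).biUnion fun j =>
        (Finset.Ici j).image fun i =>
          Finsupp.single 0 c + Finsupp.single j 1 + Finsupp.single i 1 := by
    intro a ha
    obtain ⟨b, hb, i, rfl⟩ := mem_varShift.1 ha
    obtain ⟨j, hj, rfl⟩ := Finset.mem_image.1 hb
    simp only [Finset.mem_filter, Finset.mem_univ, true_and] at hj
    simp only [Finset.mem_biUnion, Finset.mem_filter, Finset.mem_univ, true_and,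
      Finset.mem_image, Finset.mem_Ici]
    rcases le_total j i with hji | hij
    · exact ⟨j, hj, i, hji, rfl⟩
    · exact ⟨i, lt_of_le_of_lt hij hj, j, hij, add_right_comm _ _ _⟩
  refine (Finset.card_le_card hsub).trans (Finset.card_biUnion_le.trans ?_)
  refine (Finset.sum_le_sum fun j _ => Finset.card_image_le).trans (le_of_eq ?_)
  simp only [Fin.card_Ici]
  refine Finset.sum_bij (fun j _ => (j : ℕ)) (fun j hj => ?_) (fun i _ j _ h => Fin.ext h)
    (fun j hj => ?_) fun _ _ => rfl
  · simpa using hj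
  · rw [Finset.mem_range] at hj
    exact ⟨⟨j, hj.trans_le hK⟩, by simpa using hj, rfl⟩

theorem linearIndependent_monomial_one {ι σ : Type*} {f : ι → σ →₀ ℕ} (hf : Function.Injective f) :
    LinearIndependent ℂ fun i => MvPolynomial.monomial (f i) (1 : ℂ) := by
  have := (MvPolynomial.basisMonomials σ ℂ).linearIndependent.comp f hf
  rwa [MvPolynomial.coe_basisMonomials] at this

/-- If all `z₀ᶜ zⱼ zᵢ` with `j < K` are among the monomials `pₗ`, then `S` contains `z₀ᶜ zⱼ` for
`j < K`. The `pₗ` are completed by further monomials `z₀ᶜ zⱼ zᵢ`. -/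
theorem exists_le_rank_spaceS {n : ℕ} [NeZero n] (c : ℕ) {K m : ℕ} (hK : K ≤ n)
    (hm : ∑ j ∈ Finset.range K, (n - j) ≤ m) (hm' : m ≤ ∑ j ∈ Finset.range n, (n - j)) :
    ∃ p : Fin m → MvPolynomial (Fin n) ℂ, (∀ j, (p j).IsHomogeneous (c + 2)) ∧
      LinearIndependent ℂ p ∧ (K : Cardinal) ≤ Module.rank ℂ (spaceS (c + 1) p) := by
  have hsub : varShift (firstExponents n c K) ⊆ varShift (firstExponents n c n) :=
    Finset.biUnion_subset_biUnion_of_subset_left _ (firstExponents_mono c hK)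
  have hlarge : m ≤ (varShift (firstExponents n c n)).card := by
    refine hm'.trans ?_
    simpa [card_firstExponents c le_rfl] using sum_le_card_varShift (firstExponents n c n)
  obtain ⟨G, hKG, hGn, hG⟩ := Finset.exists_subsuperset_card_eq hsub
    ((card_varShift_firstExponents_le c hK).trans hm) hlarge
  let e : G ≃ Fin m := G.equivFinOfCardEq hG
  let p : Fin m → MvPolynomial (Fin n) ℂ := fun l => MvPolynomial.monomial (e.symm l : Fin n →₀ ℕ) 1
  refine ⟨p, fun l => MvPolynomial.isHomogeneous_monomial _
    (degree_of_mem_varShift_firstExponents (hGn (e.symm l).2)),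
    linearIndependent_monomial_one (Subtype.val_injective.comp e.symm.injective), ?_⟩
  have hmem : ∀ a : firstExponents n c K,
      MvPolynomial.monomial (a : Fin n →₀ ℕ) (1 : ℂ) ∈ spaceS (c + 1) p := by
    rintro ⟨a, ha⟩
    refine mem_spaceS_iff.2 ⟨MvPolynomial.isHomogeneous_monomial _
      (degree_of_mem_firstExponents ha), fun i => Submodule.subset_span
        ⟨e ⟨a + Finsupp.single i 1, hKG (mem_varShift.2 ⟨a, ha, i, rfl⟩)⟩, ?_⟩⟩
    simp [p, MvPolynomial.X, MvPolynomial.monomial_mul]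
  have hli : LinearIndependent ℂ fun a : firstExponents n c K =>
      (⟨_, hmem a⟩ : spaceS (c + 1) p) :=
    LinearIndependent.of_comp (spaceS (c + 1) p).subtype
      (linearIndependent_monomial_one Subtype.val_injective)
  simpa [card_firstExponents c hK] using hli.cardinal_le_rank

theorem lemma3p1 (n : ℕ) (hn : 2 ≤ n) (d : ℕ) (hd : 1 ≤ d) :
    (∀ (m : ℕ) (p : Fin m → MvPolynomial (Fin n) ℂ),
      (∀ j, (p j).IsHomogeneous d) → LinearIndependent ℂ p →
        (∀ k : ℕ, k ≤ n - 1 → m < ∑ j ∈ Finset.range (k + 1), (n - j) →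
          Module.rank ℂ (spaceS (d - 1) p) ≤ (k : Cardinal)) ∧
        (∀ (q : Fin m → MvPolynomial (Fin n) ℂ) (r : MvPolynomial (Fin n) ℂ),
          IsSol (d - 1) p q r → (r = 0 ↔ q = 0)) ∧
        Module.rank ℂ (spaceQ (d - 1) p) = Module.rank ℂ (spaceS (d - 1) p)) ∧
    -- sharpness of the bound `k` and of the hypothesis on `m`
    (2 ≤ d → ∀ k : ℕ, k ≤ n - 1 →
      (∀ m : ℕ, ∑ j ∈ Finset.range k, (n - j) ≤ m →
        m < ∑ j ∈ Finset.range (k + 1), (n - j) →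
        ∃ p : Fin m → MvPolynomial (Fin n) ℂ,
          (∀ j, (p j).IsHomogeneous d) ∧ LinearIndependent ℂ p ∧
            Module.rank ℂ (spaceS (d - 1) p) = (k : Cardinal)) ∧
      (∃ p : Fin (∑ j ∈ Finset.range (k + 1), (n - j)) → MvPolynomial (Fin n) ℂ,
        (∀ j, (p j).IsHomogeneous d) ∧ LinearIndependent ℂ p ∧
          (k : Cardinal) < Module.rank ℂ (spaceS (d - 1) p))) := by
  have hn0 : 0 < n := by omega
  have : NeZero n := ⟨hn0.ne'⟩
  refine ⟨fun m p _ hli => ⟨fun k _ hm => rank_spaceS_le p hm,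
    fun q r h => h.eq_zero_iff hn0 hli, rank_spaceQ_eq_rank_spaceS _ hn0 hli⟩, ?_⟩
  intro hd2 k hk
  obtain ⟨c, rfl⟩ := Nat.exists_eq_add_of_le' hd2
  have hle : ∑ j ∈ Finset.range (k + 1), (n - j) ≤ ∑ j ∈ Finset.range n, (n - j) :=
    Finset.sum_le_sum_of_subset (Finset.range_subset_range.2 (by omega))
  constructor
  · intro m hm hm'
    obtain ⟨p, hp, hli, hrank⟩ := exists_le_rank_spaceS c (by omega) hm (hm'.le.trans hle)
    exact ⟨p, hp, hli, le_antisymm (rank_spaceS_le p hm') hrank⟩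
  · obtain ⟨p, hp, hli, hrank⟩ := exists_le_rank_spaceS c (K := k + 1) (by omega) le_rfl hle
    exact ⟨p, hp, hli, lt_of_lt_of_le (by exact_mod_cast Nat.lt_succ_self k) hrank⟩
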